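/- Let $\Omega\subset\mathbb R^d$ be a bounded open set (for instance a bounded Lipschitz domain), and let $T,\varepsilon>0$, $C_A>0$, $C_\psi\ge 0$ and $c<1$. Write $(\cdot,\cdot)$ for the inner products of $L^2(\Omega)$ and $L^2(\Omega)^d$. Then there is a constant $C>0$, depending only on $\Omega,T,\varepsilon,C_A,C_\psi,c$, such that the following holds. Assumptions on $A$, $\psi$, $y_0$. Let $A\in C^1(\mathbb R^d)$ be such that $A'=\nabla A$ is strongly monotone and $|A'(p)|\le C_0|p|$ for all $p\in\mathbb R^d$, with some constant $C_0$. Let $\psi\in C^1(\mathbb R)$ be bounded from below and suppose that there are $f_n\in C^2(\mathbb R)$ with $f_n\to\psi$ in $C^1_{\rm loc}(\mathbb R)$, $-c_0\le f_n\le c_0(\psi+1)$, $f_n''\ge -C_\psi$ and $|f_n''|\le C_n$, with constants $c_0,C_n\ge0$. Let $y_0\in H^1(\Omega)$ with $\psi(y_0)\in L^1(\Omega)$. Assumptions on the regularizations. Let $(A_\delta)_{\delta\in D}$ be a family in $C^1(\mathbb R^d)$ such that for all $\delta\in D$ and all $p,q\in\mathbb R^d$ $$(A_\delta'(p)-A_\delta'(q))\cdot(p-q)\ge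 C_A|p-q|^2,\qquad |A_\delta'(p)-A'(p)|\le\eta(\delta).$$ Time grid. Let $0=t_0<t_1<\dots<t_N=T$, $\tau_j=t_j-t_{j-1}$, $I_j=(t_{j-1},t_j]$, with $$\frac{C_\psi}{\varepsilon^2}\max_j\tau_j\le c .$$ Let $u_\tau$ be a control that is constant in time on each $I_j$, with value $u_j\in L^2(\Omega)$, and let $\delta\in D$. Let $y_\tau$ and $y_\tau^\delta$ be constant in time on each $I_j$, with values $y_j,y_j^\delta\in H^1(\Omega)$, and let them solve, with $y_\tau(0)=y^\delta_\tau(0)=y_0$ (and $y_0^\delta:=y_0$), for $j=1,\dots,N$ and all $\varphi\in H^1(\Omega)$, $$\tfrac{\varepsilon}{\tau_j}(y_j,\varphi)+\varepsilon(A'(\nabla y_j),\nabla\varphi)+\tfrac1\varepsilon(\psi'(y_j),\varphi)=(u_j,\varphi)+\tfrac{\varepsilon}{\tau_j}(y_{j-1},\varphi),$$ $$\tfrac{\varepsilon}{\tau_j}(y^\delta_j,\varphi)+\varepsilon(A_\delta'(\nabla y^\delta_j),\nabla\varphi)+\tfrac1\varepsilon(\psi'(y^\delta_j),\varphi)=(u_j,\varphi)+\tfrac{\varepsilon}{\tau_j}(y^\delta_{j-1},\varphi),$$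 where $\psi'(y_j)\varphi$ and $\psi'(y_j^\delta)\varphi$ are integrable for all $\varphi\in H^1(\Omega)$. Then $$\|y_\tau-y_\tau^\delta\|_{L^\infty(0,T;L^2(\Omega))}+\|\nabla y_\tau-\nabla y_\tau^\delta\|_{L^2(0,T;L^2(\Omega))}\le C\,\eta(\delta).$$ -/

import Mathlib

open MeasureTheory Filter Topology Set
open scoped ENNReal ContDiff

namespace AllenCahn

/-- Euclidean space `ℝ^d`. -/
abbrev E (d : ℕ) : Type := EuclideanSpace ℝ (Fin d)

/-- The Lebesgue space `L²(Ω)` of real functions (classes modulo null sets). -/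
abbrev L2 {d : ℕ} (Ω : Set (E d)) : Type := Lp ℝ 2 (volume.restrict Ω)

/-- The Lebesgue space `L²(Ω)^d` of vector fields. -/
abbrev L2Vec {d : ℕ} (Ω : Set (E d)) : Type := Lp (E d) 2 (volume.restrict Ω)

/-- Test functions: smooth functions with compact support inside `Ω`. -/
structure IsTestFunction {d : ℕ} (Ω : Set (E d)) (φ : E d → ℝ) : Prop where
  smooth : ContDiff ℝ ∞ φ
  compact_support : HasCompactSupport φ
  support_subset : tsupport φ ⊆ Ω

/-- `g` is the weak gradient of `f` in `Ω`: `∫_Ω f ∇φ = - ∫_Ω φ g` for all test functions `φ`. -/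
def IsWeakGradient {d : ℕ} (Ω : Set (E d)) (f : E d → ℝ) (g : E d → E d) : Prop :=
  ∀ φ : E d → ℝ, IsTestFunction Ω φ →
    ∫ x in Ω, f x • gradient φ x = - ∫ x in Ω, φ x • g x

theorem IsTestFunction.memLp {d : ℕ} {Ω : Set (E d)} {φ : E d → ℝ} (h : IsTestFunction Ω φ) :
    MemLp φ 2 (volume.restrict Ω) :=
  h.smooth.continuous.memLp_of_hasCompactSupport h.compact_support

theorem IsTestFunction.memLp_gradient {d : ℕ} {Ω : Set (E d)} {φ : E d → ℝ}
    (h : IsTestFunction Ω φ) : MemLp (gradient φ) 2 (volume.restrict Ω) := by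
  have hc : Continuous (gradient φ) :=
    (InnerProductSpace.toDual ℝ (E d)).symm.continuous.comp
      (h.smooth.continuous_fderiv (by simp))
  have hs : HasCompactSupport (gradient φ) :=
    (h.compact_support.fderiv (𝕜 := ℝ)).comp_left (map_zero _)
  exact hc.memLp_of_hasCompactSupport hs

theorem integrable_smul_of_L2 {d : ℕ} {μ : Measure (E d)} {f : E d → ℝ} {g : E d → E d}
    (hf : MemLp f 2 μ) (hg : MemLp g 2 μ) : Integrable (fun x => f x • g x) μ :=
  memLp_one_iff_integrable.1 (hg.smul hf)

/-- The Sobolev space `H¹(Ω) = W^{1,2}(Ω)`: the pairs `(f, ∇f)` of an `L²(Ω)` function `f` and a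
weak gradient of `f` in `L²(Ω)^d`. (For open `Ω` the second entry is determined by the first.) -/
def H1 {d : ℕ} (Ω : Set (E d)) : Submodule ℝ (L2 Ω × L2Vec Ω) where
  carrier := {w | IsWeakGradient Ω w.1 w.2}
  zero_mem' := by
    intro φ hφ
    have h1 : ∫ x in Ω, ((0 : L2 Ω) : E d → ℝ) x • gradient φ x = 0 := by
      refine integral_eq_zero_of_ae ?_
      filter_upwards [Lp.coeFn_zero ℝ 2 (volume.restrict Ω)] with x hx
      rw [hx]; exact zero_smul ℝ _
    have h2 : ∫ x in Ω, φ x • ((0 : L2Vec Ω) : E d → E d) x = 0 := by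
      refine integral_eq_zero_of_ae ?_
      filter_upwards [Lp.coeFn_zero (E d) 2 (volume.restrict Ω)] with x hx
      rw [hx]; exact smul_zero _
    change ∫ x in Ω, ((0 : L2 Ω) : E d → ℝ) x • gradient φ x
      = - ∫ x in Ω, φ x • ((0 : L2Vec Ω) : E d → E d) x
    rw [h1, h2, neg_zero]
  add_mem' := by
    intro a b ha hb φ hφ
    have h1 : ∫ x in Ω, ((a.1 + b.1 : L2 Ω) : E d → ℝ) x • gradient φ x
        = (∫ x in Ω, (a.1 : E d → ℝ) x • gradient φ x)
          + ∫ x in Ω, (b.1 : E d → ℝ) x • gradient φ x := by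
      rw [← integral_add (integrable_smul_of_L2 (Lp.memLp a.1) hφ.memLp_gradient)
        (integrable_smul_of_L2 (Lp.memLp b.1) hφ.memLp_gradient)]
      refine integral_congr_ae ?_
      filter_upwards [Lp.coeFn_add a.1 b.1] with x hx
      rw [hx]; exact add_smul _ _ _
    have h2 : ∫ x in Ω, φ x • ((a.2 + b.2 : L2Vec Ω) : E d → E d) x
        = (∫ x in Ω, φ x • (a.2 : E d → E d) x) + ∫ x in Ω, φ x • (b.2 : E d → E d) x := by
      rw [← integral_add (integrable_smul_of_L2 hφ.memLp (Lp.memLp a.2))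
        (integrable_smul_of_L2 hφ.memLp (Lp.memLp b.2))]
      refine integral_congr_ae ?_
      filter_upwards [Lp.coeFn_add a.2 b.2] with x hx
      rw [hx]; exact smul_add _ _ _
    change ∫ x in Ω, ((a.1 + b.1 : L2 Ω) : E d → ℝ) x • gradient φ x
      = - ∫ x in Ω, φ x • ((a.2 + b.2 : L2Vec Ω) : E d → E d) x
    rw [h1, h2, ha φ hφ, hb φ hφ, neg_add]
  smul_mem' := by
    intro r a ha φ hφ
    have h1 : ∫ x in Ω, ((r • a.1 : L2 Ω) : E d → ℝ) x • gradient φ x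
        = r • ∫ x in Ω, (a.1 : E d → ℝ) x • gradient φ x := by
      rw [← integral_smul]
      refine integral_congr_ae ?_
      filter_upwards [Lp.coeFn_smul r a.1] with x hx
      rw [hx]; exact mul_smul r _ _
    have h2 : ∫ x in Ω, φ x • ((r • a.2 : L2Vec Ω) : E d → E d) x
        = r • ∫ x in Ω, φ x • (a.2 : E d → E d) x := by
      rw [← integral_smul]
      refine integral_congr_ae ?_
      filter_upwards [Lp.coeFn_smul r a.2] with x hx
      rw [hx]
      exact smul_comm (φ x) r ((a.2 : E d → E d) x)
    change ∫ x in Ω, ((r • a.1 : L2 Ω) : E d → ℝ) x • gradient φ x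
      = - ∫ x in Ω, φ x • ((r • a.2 : L2Vec Ω) : E d → E d) x
    rw [h1, h2, ha φ hφ, smul_neg]

/-- The underlying `L²(Ω)` function of an `H¹(Ω)` function. -/
def fn {d : ℕ} {Ω : Set (E d)} (w : H1 Ω) : L2 Ω := w.1.1

/-- The weak gradient of an `H¹(Ω)` function. -/
def wgrad {d : ℕ} {Ω : Set (E d)} (w : H1 Ω) : L2Vec Ω := w.1.2

/-- A vector field on `ℝ^d` is strongly monotone with constant `c`. -/
def StronglyMonotoneWith {d : ℕ} (c : ℝ) (F : E d → E d) : Prop :=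
  ∀ p q : E d, c * ‖p - q‖ ^ 2 ≤ inner ℝ (F p - F q) (p - q)

/-- Assumption on `A`: it is `C¹`, and `A'` is strongly monotone with `|A'(p)| ≤ C |p|`. -/
structure AnisotropyAssumption {d : ℕ} (A : E d → ℝ) : Prop where
  contDiff : ContDiff ℝ 1 A
  strongly_monotone : ∃ c : ℝ, 0 < c ∧ StronglyMonotoneWith c (gradient A)
  growth : ∃ C : ℝ, ∀ p : E d, ‖gradient A p‖ ≤ C * ‖p‖

/-- Assumption on `ψ` with the constant `Cψ`: it is `C¹`, bounded from below, and the limit in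
`C¹_loc` of `C²` functions `f_n` with `-c ≤ f_n ≤ c (ψ + 1)`, `f_n'' ≥ -Cψ`, `|f_n''| ≤ C_n`. -/
structure PotentialAssumption (ψ : ℝ → ℝ) (Cψ : ℝ) : Prop where
  contDiff : ContDiff ℝ 1 ψ
  bddBelow : BddBelow (range ψ)
  nonneg : 0 ≤ Cψ
  approx : ∃ (f : ℕ → ℝ → ℝ) (c : ℝ), 0 ≤ c ∧
    (∀ n, ContDiff ℝ 2 (f n)) ∧
    TendstoLocallyUniformly f ψ atTop ∧
    TendstoLocallyUniformly (fun n => deriv (f n)) (deriv ψ) atTop ∧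
    (∀ n s, -c ≤ f n s ∧ f n s ≤ c * (ψ s + 1)) ∧
    (∀ n s, -Cψ ≤ deriv (deriv (f n)) s) ∧
    (∀ n, ∃ Cn : ℝ, ∀ s, |deriv (deriv (f n)) s| ≤ Cn)

/-- `0 = t_0 < t_1 < ⋯ < t_N = T`. -/
structure IsTimeGrid (T : ℝ) (N : ℕ) (t : Fin (N + 1) → ℝ) : Prop where
  strictMono : StrictMono t
  first : t 0 = 0
  last : t (Fin.last N) = T

/-- The step size `τ_j = t_j - t_{j-1}` of the interval `I_j = (t_{j-1}, t_j]`; here and below the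
intervals are indexed by `j : Fin N`, with end points `t j.castSucc` and `t j.succ`. -/
def stepSize {N : ℕ} (t : Fin (N + 1) → ℝ) (j : Fin N) : ℝ := t j.succ - t j.castSucc

/-- A time dependent function is constant on each interval `I_j = (t_{j-1}, t_j]`; its constant
value there is the value at `t_j`. With `X = H¹(Ω)` and `X = L²(Ω)` these are the spaces of
discrete states and of discrete controls. -/
def IsPiecewiseConst {X : Type*} {N : ℕ} (t : Fin (N + 1) → ℝ) (v : ℝ → X) : Prop :=
  ∀ j : Fin N, ∀ s ∈ Ioc (t j.castSucc) (t j.succ), v s = v (t j.succ)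

/-- `y` is a discrete state for the control `u`, that is a piecewise constant function with values
in `H¹(Ω)`, `y(0) = y₀`, such that in each time step and for all `φ ∈ H¹(Ω)`
`ε/τ_j (y_j, φ) + ε (A'(∇y_j), ∇φ) + 1/ε (ψ'(y_j), φ) = (u_j, φ) + ε/τ_j (y_{j-1}, φ)`.
The integrability clause gives `(ψ'(y_j), φ)` a meaning. -/
structure IsDiscreteState {d : ℕ} (Ω : Set (E d)) (ε : ℝ) (A : E d → ℝ) (ψ : ℝ → ℝ)
    {N : ℕ} (t : Fin (N + 1) → ℝ) (y₀ : H1 Ω) (u : ℝ → L2 Ω) (y : ℝ → H1 Ω) : Prop where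
  piecewise_const : IsPiecewiseConst t y
  initial : y 0 = y₀
  integrable : ∀ j : Fin N, ∀ φ : H1 Ω,
    IntegrableOn (fun x => deriv ψ (fn (y (t j.succ)) x) * fn φ x) Ω
  equation : ∀ j : Fin N, ∀ φ : H1 Ω,
    ε / stepSize t j * inner ℝ (fn (y (t j.succ))) (fn φ)
      + ε * (∫ x in Ω, inner ℝ (gradient A (wgrad (y (t j.succ)) x)) (wgrad φ x))
      + 1 / ε * (∫ x in Ω, deriv ψ (fn (y (t j.succ)) x) * fn φ x)
    = inner ℝ (u (t j.succ)) (fn φ)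
      + ε / stepSize t j * inner ℝ (fn (y (t j.castSucc))) (fn φ)

end AllenCahn

/-!
Test the difference of the two schemes at step `j` with the error `e_j = y_j - y_j^δ` itself. Strong
monotonicity of `A_δ'` controls `‖∇e_j‖²` up to `η²`, the one-sided bound `ψ'' ≥ -Cψ` costs at most
`Cψ ‖e_j‖²`, and the result is `(1 - s) ‖e_j‖² + τ_j C_A ‖∇e_j‖² / 2 ≤ (e_{j-1}, e_j) + O(τ_j η²)`
with `s = Cψ τ_j / ε² ≤ c < 1`. Multiplying by `1 - s` before completing the square, rather than
estimating `(e_{j-1}, e_j)` by `(‖e_{j-1}‖² + ‖e_j‖²) / 2`, is what makes every `c < 1` admissible: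
the growth factor per step is `(1 - s)⁻² ≤ exp (2 s / (1 - c))`, and a discrete Gronwall argument
bounds `‖e_j‖²` and the sum of the `τ_i ‖∇e_i‖²` simultaneously.
-/

namespace AllenCahn

open scoped InnerProductSpace

section OneSidedLipschitz

theorem mul_sub_sq_le_of_le_deriv {g : ℝ → ℝ} {k : ℝ} (hg : Differentiable ℝ g)
    (hk : ∀ s, k ≤ deriv g s) (a b : ℝ) : k * (a - b) ^ 2 ≤ (g a - g b) * (a - b) := by
  rcases le_total a b with hab | hba
  · nlinarith [mul_sub_le_image_sub_of_le_deriv hg hk hab]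
  · nlinarith [mul_sub_le_image_sub_of_le_deriv hg hk hba]

theorem PotentialAssumption.neg_mul_sub_sq_le {ψ : ℝ → ℝ} {Cψ : ℝ}
    (h : PotentialAssumption ψ Cψ) (a b : ℝ) :
    -Cψ * (a - b) ^ 2 ≤ (deriv ψ a - deriv ψ b) * (a - b) := by
  obtain ⟨f, -, -, hf, -, hf', -, hf'', -⟩ := h.approx
  have deriv_tendsto (s : ℝ) : Tendsto (fun n => deriv (f n) s) atTop (𝓝 (deriv ψ s)) :=
    (tendstoLocallyUniformlyOn_univ.2 hf').tendsto_at (mem_univ s)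
  have approx_le (n : ℕ) : -Cψ * (a - b) ^ 2 ≤ (deriv (f n) a - deriv (f n) b) * (a - b) :=
    mul_sub_sq_le_of_le_deriv ((hf n).differentiable_deriv_two) (hf'' n) a b
  exact ge_of_tendsto' (((deriv_tendsto a).sub (deriv_tendsto b)).mul_const (a - b)) approx_le

end OneSidedLipschitz

section MonotoneFields

variable {α : Type*} [MeasurableSpace α] {μ : Measure α}

theorem memLp_comp_of_norm_le_mul_add [IsFiniteMeasure μ] {X Y : Type*} [NormedAddCommGroup X]
    [NormedAddCommGroup Y] {p : ℝ≥0∞} {F : X → Y} {C b : ℝ} (hF : Continuous F)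
    (hC : ∀ x, ‖F x‖ ≤ C * ‖x‖ + b) {g : α → X} (hg : MemLp g p μ) :
    MemLp (fun x => F (g x)) p μ :=
  ((hg.norm.const_mul C).add (memLp_const b)).mono' (hF.comp_aestronglyMeasurable hg.1)
    (Eventually.of_forall fun x => hC (g x))

variable {V : Type*} [NormedAddCommGroup V] [InnerProductSpace ℝ V] {F G : V → V}

theorem half_mul_norm_sub_sq_sub_le_inner {c η : ℝ} (hc : 0 < c)
    (hG : ∀ p q, c * ‖p - q‖ ^ 2 ≤ ⟪G p - G q, p - q⟫_ℝ) (hFG : ∀ p, ‖G p - F p‖ ≤ η) (p q : V) :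
    c / 2 * ‖p - q‖ ^ 2 - η ^ 2 / (2 * c) ≤ ⟪F p - G q, p - q⟫_ℝ := by
  have perturbation : ⟪G p - F p, p - q⟫_ℝ ≤ η * ‖p - q‖ :=
    (real_inner_le_norm _ _).trans (by gcongr; exact hFG p)
  have young : η * ‖p - q‖ ≤ c / 2 * ‖p - q‖ ^ 2 + η ^ 2 / (2 * c) := by
    have : c / 2 * ‖p - q‖ ^ 2 + η ^ 2 / (2 * c) - η * ‖p - q‖
        = (c * ‖p - q‖ - η) ^ 2 / (2 * c) := by field_simp; ring
    have : 0 ≤ (c * ‖p - q‖ - η) ^ 2 / (2 * c) := by positivity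
    linarith
  calc c / 2 * ‖p - q‖ ^ 2 - η ^ 2 / (2 * c)
      ≤ c * ‖p - q‖ ^ 2 - η * ‖p - q‖ := by linarith
    _ ≤ ⟪G p - G q, p - q⟫_ℝ - ⟪G p - F p, p - q⟫_ℝ := sub_le_sub (hG p q) perturbation
    _ = ⟪F p - G q, p - q⟫_ℝ := by rw [← inner_sub_left, sub_sub_sub_cancel_left]

variable [IsFiniteMeasure μ]

theorem mul_norm_sub_sq_sub_le_integral_inner {k b : ℝ}
    (h : ∀ p q, k * ‖p - q‖ ^ 2 - b ≤ ⟪F p - G q, p - q⟫_ℝ) {v w : Lp V 2 μ}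
    (hv : Integrable (fun x => ⟪F (v x), (v - w) x⟫_ℝ) μ)
    (hw : Integrable (fun x => ⟪G (w x), (v - w) x⟫_ℝ) μ) :
    k * ‖v - w‖ ^ 2 - b * μ.real univ ≤
      (∫ x, ⟪F (v x), (v - w) x⟫_ℝ ∂μ) - ∫ x, ⟪G (w x), (v - w) x⟫_ℝ ∂μ := by
  have hsq : Integrable (fun x => k * ⟪(v - w) x, (v - w) x⟫_ℝ - b) μ :=
    ((L2.integrable_inner (v - w) (v - w)).const_mul k).sub (integrable_const b)
  calc k * ‖v - w‖ ^ 2 - b * μ.real univ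
      = ∫ x, (k * ⟪(v - w) x, (v - w) x⟫_ℝ - b) ∂μ := by
        rw [integral_sub ((L2.integrable_inner _ _).const_mul k) (integrable_const b),
          integral_const_mul, integral_const, smul_eq_mul, mul_comm b,
          ← real_inner_self_eq_norm_sq, L2.inner_def]
    _ ≤ ∫ x, (⟪F (v x), (v - w) x⟫_ℝ - ⟪G (w x), (v - w) x⟫_ℝ) ∂μ := by
        refine integral_mono_ae hsq (hv.sub hw) ?_
        filter_upwards [Lp.coeFn_sub v w] with x hx
        rw [← inner_sub_left, hx, Pi.sub_apply, real_inner_self_eq_norm_sq]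
        exact h (v x) (w x)
    _ = _ := integral_sub hv hw

theorem integrable_inner_comp {C b : ℝ} (hF : Continuous F) (hC : ∀ p, ‖F p‖ ≤ C * ‖p‖ + b)
    (v w : Lp V 2 μ) : Integrable (fun x => ⟪F (v x), w x⟫_ℝ) μ := by
  have hFv : MemLp (fun x => F (v x)) 2 μ := memLp_comp_of_norm_le_mul_add hF hC (Lp.memLp v)
  refine (L2.integrable_inner (𝕜 := ℝ) (hFv.toLp _) w).congr ?_
  filter_upwards [hFv.coeFn_toLp] with x hx
  rw [hx]

theorem half_mul_norm_sub_sq_sub_le_integral_inner {c η C b : ℝ} (hc : 0 < c) (hF : Continuous F)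
    (hC : ∀ p, ‖F p‖ ≤ C * ‖p‖ + b) (hG : Continuous G)
    (hmono : ∀ p q, c * ‖p - q‖ ^ 2 ≤ ⟪G p - G q, p - q⟫_ℝ) (hFG : ∀ p, ‖G p - F p‖ ≤ η)
    (v w : Lp V 2 μ) :
    c / 2 * ‖v - w‖ ^ 2 - η ^ 2 / (2 * c) * μ.real univ ≤
      (∫ x, ⟪F (v x), (v - w) x⟫_ℝ ∂μ) - ∫ x, ⟪G (w x), (v - w) x⟫_ℝ ∂μ := by
  have growth_G (p : V) : ‖G p‖ ≤ C * ‖p‖ + (b + η) := by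
    linarith [norm_le_norm_add_norm_sub' (G p) (F p), hC p, hFG p]
  exact mul_norm_sub_sq_sub_le_integral_inner (half_mul_norm_sub_sq_sub_le_inner hc hmono hFG)
    (integrable_inner_comp hF hC v _) (integrable_inner_comp hG growth_G w _)

theorem mul_norm_sub_sq_le_integral_mul {f : ℝ → ℝ} {k : ℝ}
    (h : ∀ a b, k * (a - b) ^ 2 ≤ (f a - f b) * (a - b)) {v w : Lp ℝ 2 μ}
    (hv : Integrable (fun x => f (v x) * (v - w) x) μ)
    (hw : Integrable (fun x => f (w x) * (v - w) x) μ) :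
    k * ‖v - w‖ ^ 2 ≤ (∫ x, f (v x) * (v - w) x ∂μ) - ∫ x, f (w x) * (v - w) x ∂μ := by
  have inner_eq (a b : ℝ) : ⟪a, b⟫_ℝ = a * b := by simp [mul_comm]
  simpa only [inner_eq, zero_mul, sub_zero] using
    mul_norm_sub_sq_sub_le_integral_inner (F := f) (G := f) (k := k) (b := 0) (v := v) (w := w)
      (fun a b => by
        rw [inner_eq, sub_zero, Real.norm_eq_abs, sq_abs]
        exact h a b) (by simpa only [inner_eq] using hv)
      (by simpa only [inner_eq] using hw)

end MonotoneFields

section Gronwall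

theorem one_le_exp_div_mul_one_sub {s c : ℝ} (hs : 0 ≤ s) (hsc : s ≤ c) (hc : c < 1) :
    1 ≤ Real.exp (s / (1 - c)) * (1 - s) := by
  have : 0 < 1 - c := by linarith
  have one_sub_s_pos : 0 < 1 - s := by linarith
  calc (1 : ℝ) = (s / (1 - s) + 1) * (1 - s) := by field_simp; ring
    _ ≤ (s / (1 - c) + 1) * (1 - s) := by gcongr
    _ ≤ Real.exp (s / (1 - c)) * (1 - s) := by gcongr; exact Real.add_one_le_exp _

variable {H : Type*} [NormedAddCommGroup H] [InnerProductSpace ℝ H]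

theorem sq_mul_norm_sq_add_le {θ a b : ℝ} (hθ₀ : 0 ≤ θ) (hθ₁ : θ ≤ 1) (ha : 0 ≤ a) (hb : 0 ≤ b)
    {e e' : H} (h : θ * ‖e‖ ^ 2 + a / 2 ≤ ⟪e', e⟫_ℝ + b / 2) :
    θ ^ 2 * (‖e‖ ^ 2 + a) ≤ ‖e'‖ ^ 2 + b := by
  have square_completed : 2 * (θ * ⟪e', e⟫_ℝ) ≤ θ ^ 2 * ‖e‖ ^ 2 + ‖e'‖ ^ 2 := by
    have := norm_sub_sq_real e' (θ • e)
    rw [inner_smul_right, norm_smul, mul_pow, Real.norm_eq_abs, sq_abs] at this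
    linarith [sq_nonneg ‖e' - θ • e‖]
  have h_mul_θ := mul_le_mul_of_nonneg_left h hθ₀
  have : θ ^ 2 * a ≤ θ * a := by gcongr; nlinarith
  have : θ * b ≤ b := mul_le_of_le_one_left hb hθ₁
  linarith

theorem norm_sq_add_le_exp_mul {s c a b : ℝ} (hs : 0 ≤ s) (hsc : s ≤ c) (hc : c < 1) (ha : 0 ≤ a)
    (hb : 0 ≤ b) {e e' : H} (h : (1 - s) * ‖e‖ ^ 2 + a / 2 ≤ ⟪e', e⟫_ℝ + b / 2) :
    ‖e‖ ^ 2 + a ≤ Real.exp (2 * (s / (1 - c))) * (‖e'‖ ^ 2 + b) := by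
  calc ‖e‖ ^ 2 + a ≤ (Real.exp (s / (1 - c)) * (1 - s)) ^ 2 * (‖e‖ ^ 2 + a) :=
        le_mul_of_one_le_left (by positivity) (one_le_pow₀ (one_le_exp_div_mul_one_sub hs hsc hc))
    _ = Real.exp (2 * (s / (1 - c))) * ((1 - s) ^ 2 * (‖e‖ ^ 2 + a)) := by
        rw [two_mul, Real.exp_add]; ring
    _ ≤ Real.exp (2 * (s / (1 - c))) * (‖e'‖ ^ 2 + b) := by
        gcongr
        exact sq_mul_norm_sq_add_le (by linarith) (by linarith) ha hb h

theorem le_exp_mul_add_of_succ_le {N : ℕ} {t S : Fin (N + 1) → ℝ} {K R : ℝ} (ht : Monotone t)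
    (hK : 0 ≤ K) (hR : 0 ≤ R)
    (h : ∀ j : Fin N,
      S j.succ ≤ Real.exp (K * stepSize t j) * (S j.castSucc + stepSize t j * R))
    (i : Fin (N + 1)) : S i ≤ Real.exp (K * (t i - t 0)) * (S 0 + (t i - t 0) * R) := by
  induction i using Fin.induction with
  | zero => simp
  | succ j ih =>
    have hτ : 0 ≤ stepSize t j := sub_nonneg.2 (ht (Fin.castSucc_le_succ j))
    have one_le_exp : 1 ≤ Real.exp (K * (t j.castSucc - t 0)) :=
      Real.one_le_exp (mul_nonneg hK (sub_nonneg.2 (ht (Fin.zero_le _))))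
    have step_eq : t j.succ - t 0 = stepSize t j + (t j.castSucc - t 0) := by
      rw [stepSize]; ring
    calc S j.succ ≤ Real.exp (K * stepSize t j) * (S j.castSucc + stepSize t j * R) := h j
      _ ≤ Real.exp (K * stepSize t j) * (Real.exp (K * (t j.castSucc - t 0))
            * (S 0 + (t j.castSucc - t 0) * R)
            + Real.exp (K * (t j.castSucc - t 0)) * (stepSize t j * R)) :=
          mul_le_mul_of_nonneg_left (add_le_add ih
            (le_mul_of_one_le_left (mul_nonneg hτ hR) one_le_exp)) (Real.exp_nonneg _)
      _ = Real.exp (K * (t j.succ - t 0)) * (S 0 + (t j.succ - t 0) * R) := by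
          rw [step_eq, mul_add K, Real.exp_add]; ring

theorem partialSum_nonneg {N : ℕ} {g : Fin N → ℝ} (hg : ∀ j, 0 ≤ g j) (i : Fin (N + 1)) :
    0 ≤ Fin.partialSum g i :=
  List.sum_nonneg fun x hx => by
    obtain ⟨j, rfl⟩ := List.mem_ofFn.1 (List.mem_of_mem_take hx)
    exact hg j

theorem partialSum_last {N : ℕ} (g : Fin N → ℝ) : Fin.partialSum g (Fin.last N) = ∑ j, g j := by
  rw [Fin.partialSum, List.take_of_length_le (by simp), List.sum_ofFn]

theorem add_partialSum_le_exp_mul {N : ℕ} {t a : Fin (N + 1) → ℝ} {g : Fin N → ℝ} {K R : ℝ}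
    (ht : Monotone t) (hK : 0 ≤ K) (hR : 0 ≤ R) (hg : ∀ j, 0 ≤ g j)
    (h : ∀ j : Fin N, a j.succ + g j ≤
      Real.exp (K * stepSize t j) * (a j.castSucc + stepSize t j * R))
    (i : Fin (N + 1)) :
    a i + Fin.partialSum g i ≤ Real.exp (K * (t i - t 0)) * (a 0 + (t i - t 0) * R) := by
  have step (j : Fin N) : a j.succ + Fin.partialSum g j.succ ≤ Real.exp (K * stepSize t j)
      * (a j.castSucc + Fin.partialSum g j.castSucc + stepSize t j * R) := by
    have one_le_exp : 1 ≤ Real.exp (K * stepSize t j) :=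
      Real.one_le_exp (mul_nonneg hK (sub_nonneg.2 (ht (Fin.castSucc_le_succ j))))
    rw [Fin.partialSum_succ]
    linarith [h j, le_mul_of_one_le_left (partialSum_nonneg hg j.castSucc) one_le_exp]
  simpa using le_exp_mul_add_of_succ_le (S := fun i => a i + Fin.partialSum g i) ht hK hR step i

end Gronwall

section PiecewiseConst

variable {N : ℕ} {t : Fin (N + 1) → ℝ}

theorem Ioc_subset_iUnion_Ioc_castSucc_succ (t : Fin (N + 1) → ℝ) :
    Ioc (t 0) (t (Fin.last N)) ⊆ ⋃ j : Fin N, Ioc (t j.castSucc) (t j.succ) := by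
  suffices ∀ i, Ioc (t 0) (t i) ⊆ ⋃ j : Fin N, Ioc (t j.castSucc) (t j.succ) from this _
  intro i
  induction i using Fin.induction with
  | zero => simp
  | succ j ih =>
    exact Ioc_subset_Ioc_union_Ioc.trans (union_subset ih
      (subset_iUnion (fun j : Fin N => Ioc (t j.castSucc) (t j.succ)) j))

variable {X : Type*} {v : ℝ → X}

theorem IsPiecewiseConst.map₂ {Y Z : Type*} {w : ℝ → Y} (hv : IsPiecewiseConst t v)
    (hw : IsPiecewiseConst t w) (f : X → Y → Z) : IsPiecewiseConst t fun s => f (v s) (w s) :=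
  fun j s hs => congrArg₂ f (hv j s hs) (hw j s hs)

theorem IsPiecewiseConst.lintegral_comp_le (hv : IsPiecewiseConst t v) (f : X → ℝ≥0∞) :
    ∫⁻ s in Ioc (t 0) (t (Fin.last N)), f (v s) ≤
      ∑ j : Fin N, ENNReal.ofReal (stepSize t j) * f (v (t j.succ)) := by
  calc ∫⁻ s in Ioc (t 0) (t (Fin.last N)), f (v s)
      ≤ ∫⁻ s in ⋃ j : Fin N, Ioc (t j.castSucc) (t j.succ), f (v s) :=
        lintegral_mono_set (Ioc_subset_iUnion_Ioc_castSucc_succ t)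
    _ ≤ ∑ j : Fin N, ∫⁻ s in Ioc (t j.castSucc) (t j.succ), f (v s) :=
        (lintegral_iUnion_le _ _).trans_eq (tsum_fintype _)
    _ = ∑ j : Fin N, ENNReal.ofReal (stepSize t j) * f (v (t j.succ)) := by
        refine Finset.sum_congr rfl fun j _ => ?_
        rw [setLIntegral_congr_fun measurableSet_Ioc fun s hs => congrArg f (hv j s hs),
          setLIntegral_const, Real.volume_Ioc, mul_comm, stepSize]

variable [NormedAddCommGroup X]

theorem IsPiecewiseConst.eLpNorm_top_le {b : ℝ} (hv : IsPiecewiseConst t v)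
    (hb : ∀ j : Fin N, ‖v (t j.succ)‖ ≤ b) :
    eLpNorm v ∞ (volume.restrict (Ioc (t 0) (t (Fin.last N)))) ≤ ENNReal.ofReal b := by
  refine eLpNormEssSup_le_of_ae_bound ?_
  filter_upwards [ae_restrict_mem measurableSet_Ioc] with s hs
  obtain ⟨j, hj⟩ := mem_iUnion.1 (Ioc_subset_iUnion_Ioc_castSucc_succ t hs)
  exact hv j s hj ▸ hb j

theorem IsPiecewiseConst.eLpNorm_two_le (ht : Monotone t) (hv : IsPiecewiseConst t v) :
    eLpNorm v 2 (volume.restrict (Ioc (t 0) (t (Fin.last N)))) ≤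
      ENNReal.ofReal √(∑ j : Fin N, stepSize t j * ‖v (t j.succ)‖ ^ 2) := by
  have hτ (j : Fin N) : 0 ≤ stepSize t j := sub_nonneg.2 (ht (Fin.castSucc_le_succ j))
  have sum_nonneg : 0 ≤ ∑ j : Fin N, stepSize t j * ‖v (t j.succ)‖ ^ 2 :=
    Finset.sum_nonneg fun j _ => mul_nonneg (hτ j) (sq_nonneg _)
  have lintegral_le : ∫⁻ s in Ioc (t 0) (t (Fin.last N)), ‖v s‖ₑ ^ (2 : ℝ) ≤
      ENNReal.ofReal (∑ j : Fin N, stepSize t j * ‖v (t j.succ)‖ ^ 2) := by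
    refine (hv.lintegral_comp_le fun x => ‖x‖ₑ ^ (2 : ℝ)).trans_eq ?_
    rw [ENNReal.ofReal_sum_of_nonneg fun j _ => mul_nonneg (hτ j) (sq_nonneg _)]
    refine Finset.sum_congr rfl fun j _ => ?_
    rw [ENNReal.ofReal_mul (hτ j), ENNReal.ofReal_pow (norm_nonneg _), ofReal_norm,
      ENNReal.rpow_ofNat]
  rw [eLpNorm_eq_lintegral_rpow_enorm_toReal (by simp) (by simp), ENNReal.toReal_ofNat,
    Real.sqrt_eq_rpow, ← ENNReal.ofReal_rpow_of_nonneg sum_nonneg (by norm_num)]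
  exact ENNReal.rpow_le_rpow lintegral_le (by norm_num)

end PiecewiseConst

section DiscreteStates

variable {d : ℕ} {Ω : Set (E d)} {ε : ℝ} {A B : E d → ℝ} {ψ : ℝ → ℝ} {N : ℕ}
  {t : Fin (N + 1) → ℝ} {y₀ z₀ : H1 Ω} {u : ℝ → L2 Ω} {y z : ℝ → H1 Ω}

theorem continuous_gradient (hA : ContDiff ℝ 1 A) : Continuous (gradient A) :=
  (InnerProductSpace.toDual ℝ (E d)).symm.continuous.comp (hA.continuous_fderiv one_ne_zero)

theorem fn_sub (v w : H1 Ω) : fn (v - w) = fn v - fn w := rfl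

theorem wgrad_sub (v w : H1 Ω) : wgrad (v - w) = wgrad v - wgrad w := rfl

theorem IsDiscreteState.error_equation (hε : ε ≠ 0) (hy : IsDiscreteState Ω ε A ψ t y₀ u y)
    (hz : IsDiscreteState Ω ε B ψ t z₀ u z) {j : Fin N} (hτ : stepSize t j ≠ 0) (φ : H1 Ω) :
    ⟪fn (y (t j.succ)) - fn (z (t j.succ)), fn φ⟫_ℝ
      + stepSize t j * ((∫ x in Ω, ⟪gradient A (wgrad (y (t j.succ)) x), wgrad φ x⟫_ℝ)
        - ∫ x in Ω, ⟪gradient B (wgrad (z (t j.succ)) x), wgrad φ x⟫_ℝ)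
      + stepSize t j / ε ^ 2 * ((∫ x in Ω, deriv ψ (fn (y (t j.succ)) x) * fn φ x)
        - ∫ x in Ω, deriv ψ (fn (z (t j.succ)) x) * fn φ x)
    = ⟪fn (y (t j.castSucc)) - fn (z (t j.castSucc)), fn φ⟫_ℝ := by
  have equation_y := hy.equation j φ
  have equation_z := hz.equation j φ
  rw [inner_sub_left, inner_sub_left]
  field_simp at equation_y equation_z ⊢
  linear_combination equation_y - equation_z

variable [IsFiniteMeasure (volume.restrict Ω)] {C_A Cψ c C b η : ℝ}

theorem IsDiscreteState.error_step (hε : ε ≠ 0) (hC_A : 0 < C_A) (hA : ContDiff ℝ 1 A)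
    (hgrowth : ∀ p, ‖gradient A p‖ ≤ C * ‖p‖ + b)
    (hψ : ∀ r s, -Cψ * (r - s) ^ 2 ≤ (deriv ψ r - deriv ψ s) * (r - s))
    (hB : ContDiff ℝ 1 B) (hmono : StronglyMonotoneWith C_A (gradient B))
    (hAB : ∀ p, ‖gradient B p - gradient A p‖ ≤ η)
    (hy : IsDiscreteState Ω ε A ψ t y₀ u y) (hz : IsDiscreteState Ω ε B ψ t z₀ u z)
    {j : Fin N} (hτ : 0 < stepSize t j) :
    (1 - Cψ / ε ^ 2 * stepSize t j) * ‖fn (y (t j.succ)) - fn (z (t j.succ))‖ ^ 2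
        + C_A * (stepSize t j * ‖wgrad (y (t j.succ)) - wgrad (z (t j.succ))‖ ^ 2) / 2 ≤
      ⟪fn (y (t j.castSucc)) - fn (z (t j.castSucc)),
          fn (y (t j.succ)) - fn (z (t j.succ))⟫_ℝ
        + stepSize t j * (η ^ 2 * (volume.restrict Ω).real univ / C_A) / 2 := by
  have potential_integrable := hy.integrable j (y (t j.succ) - z (t j.succ))
  have potential_integrable' := hz.integrable j (y (t j.succ) - z (t j.succ))
  have equation := hy.error_equation hε hz hτ.ne' (y (t j.succ) - z (t j.succ))
  simp only [fn_sub, wgrad_sub, real_inner_self_eq_norm_sq]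
    at potential_integrable potential_integrable' equation
  have gradient_bound := mul_le_mul_of_nonneg_left
    (half_mul_norm_sub_sq_sub_le_integral_inner hC_A (continuous_gradient hA) hgrowth
      (continuous_gradient hB) hmono hAB (wgrad (y (t j.succ))) (wgrad (z (t j.succ)))) hτ.le
  have potential_bound := mul_le_mul_of_nonneg_left
    (mul_norm_sub_sq_le_integral_mul hψ potential_integrable potential_integrable')
    (by positivity : 0 ≤ stepSize t j / ε ^ 2)
  linear_combination gradient_bound + potential_bound + equation

theorem IsDiscreteState.error_energy_le (hε : ε ≠ 0) (hC_A : 0 < C_A) (hCψ : 0 ≤ Cψ) (hc : c < 1)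
    (hA : ContDiff ℝ 1 A) (hgrowth : ∀ p, ‖gradient A p‖ ≤ C * ‖p‖ + b)
    (hψ : ∀ r s, -Cψ * (r - s) ^ 2 ≤ (deriv ψ r - deriv ψ s) * (r - s))
    (hB : ContDiff ℝ 1 B) (hmono : StronglyMonotoneWith C_A (gradient B))
    (hAB : ∀ p, ‖gradient B p - gradient A p‖ ≤ η)
    (ht : StrictMono t) (hstep : ∀ j, Cψ / ε ^ 2 * stepSize t j ≤ c)
    (hy : IsDiscreteState Ω ε A ψ t y₀ u y) (hz : IsDiscreteState Ω ε B ψ t z₀ u z)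
    (i : Fin (N + 1)) :
    ‖fn (y (t i)) - fn (z (t i))‖ ^ 2 + Fin.partialSum (fun j : Fin N =>
        C_A * (stepSize t j * ‖wgrad (y (t j.succ)) - wgrad (z (t j.succ))‖ ^ 2)) i ≤
      Real.exp (2 * (Cψ / ε ^ 2) / (1 - c) * (t i - t 0))
        * (‖fn (y (t 0)) - fn (z (t 0))‖ ^ 2
          + (t i - t 0) * (η ^ 2 * (volume.restrict Ω).real univ / C_A)) := by
  have hτ (j : Fin N) : 0 < stepSize t j := sub_pos.2 (ht Fin.castSucc_lt_succ)
  have : 0 < 1 - c := by linarith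
  refine add_partialSum_le_exp_mul (a := fun i => ‖fn (y (t i)) - fn (z (t i))‖ ^ 2) ht.monotone
    (by positivity) (by positivity) (fun j => ?_) (fun j => ?_) i
  · have := hτ j
    positivity
  · have := hτ j
    rw [show 2 * (Cψ / ε ^ 2) / (1 - c) * stepSize t j
      = 2 * (Cψ / ε ^ 2 * stepSize t j / (1 - c)) by ring]
    exact norm_sq_add_le_exp_mul (by positivity) (hstep j) hc (by positivity) (by positivity)
      (hy.error_step hε hC_A hA hgrowth hψ hB hmono hAB hz (hτ j))

theorem IsDiscreteState.error_sq_le {T : ℝ} (hε : ε ≠ 0) (hC_A : 0 < C_A) (hCψ : 0 ≤ Cψ)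
    (hc : c < 1) (hA : ContDiff ℝ 1 A) (hgrowth : ∀ p, ‖gradient A p‖ ≤ C * ‖p‖ + b)
    (hψ : ∀ r s, -Cψ * (r - s) ^ 2 ≤ (deriv ψ r - deriv ψ s) * (r - s))
    (hB : ContDiff ℝ 1 B) (hmono : StronglyMonotoneWith C_A (gradient B))
    (hAB : ∀ p, ‖gradient B p - gradient A p‖ ≤ η)
    (ht : IsTimeGrid T N t) (hstep : ∀ j, Cψ / ε ^ 2 * stepSize t j ≤ c)
    (hy : IsDiscreteState Ω ε A ψ t y₀ u y) (hz : IsDiscreteState Ω ε B ψ t y₀ u z) :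
    (∀ i, ‖fn (y (t i)) - fn (z (t i))‖ ^ 2 ≤
      Real.exp (2 * (Cψ / ε ^ 2) / (1 - c) * T)
        * (T * (volume.restrict Ω).real univ / C_A) * η ^ 2) ∧
    C_A * ∑ j : Fin N, stepSize t j * ‖wgrad (y (t j.succ)) - wgrad (z (t j.succ))‖ ^ 2 ≤
      Real.exp (2 * (Cψ / ε ^ 2) / (1 - c) * T)
        * (T * (volume.restrict Ω).real univ / C_A) * η ^ 2 := by
  have energy (i : Fin (N + 1)) := hy.error_energy_le hε hC_A hCψ hc hA hgrowth hψ hB hmono hAB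
    ht.strictMono hstep hz i
  simp only [ht.first, hy.initial, hz.initial, sub_self, norm_zero, sub_zero, zero_pow two_ne_zero,
    zero_add] at energy
  have bound_mono (i : Fin (N + 1)) :
      Real.exp (2 * (Cψ / ε ^ 2) / (1 - c) * t i)
          * (t i * (η ^ 2 * (volume.restrict Ω).real univ / C_A)) ≤
        Real.exp (2 * (Cψ / ε ^ 2) / (1 - c) * T)
          * (T * (volume.restrict Ω).real univ / C_A) * η ^ 2 := by
    have t_nonneg : 0 ≤ t i := ht.first ▸ ht.strictMono.monotone (Fin.zero_le i)
    have t_le : t i ≤ T := ht.last ▸ ht.strictMono.monotone (Fin.le_last i)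
    have : 0 < 1 - c := by linarith
    calc _ = Real.exp (2 * (Cψ / ε ^ 2) / (1 - c) * t i)
          * (t i * (volume.restrict Ω).real univ / C_A) * η ^ 2 := by ring
      _ ≤ _ := by gcongr
  have gradient_term_nonneg (j : Fin N) :
      0 ≤ C_A * (stepSize t j * ‖wgrad (y (t j.succ)) - wgrad (z (t j.succ))‖ ^ 2) :=
    mul_nonneg hC_A.le (mul_nonneg
      (sub_nonneg.2 (ht.strictMono.monotone (Fin.castSucc_le_succ j))) (sq_nonneg _))
  refine ⟨fun i => ?_, ?_⟩
  · linarith [energy i, bound_mono i, partialSum_nonneg gradient_term_nonneg i]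
  · have energy_last := energy (Fin.last N)
    rw [partialSum_last, ← Finset.mul_sum] at energy_last
    linarith [bound_mono (Fin.last N),
      sq_nonneg ‖fn (y (t (Fin.last N))) - fn (z (t (Fin.last N)))‖]

end DiscreteStates

end AllenCahn

open AllenCahn in
theorem mainTheorem6_general {d : ℕ} (Ω : Set (E d)) (hΩ : volume Ω ≠ ⊤) (T ε : ℝ) (hε : ε ≠ 0)
    (C_A Cψ c : ℝ) (hC_A : 0 < C_A) (hc : c < 1) :
    ∃ C : ℝ, 0 < C ∧
      ∀ (A B : E d → ℝ) (ψ : ℝ → ℝ) (y₀ : H1 Ω) (C₀ C₁ η : ℝ),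
        ContDiff ℝ 1 A → (∀ p, ‖gradient A p‖ ≤ C₀ * ‖p‖ + C₁) →
        0 ≤ Cψ → (∀ r s, -Cψ * (r - s) ^ 2 ≤ (deriv ψ r - deriv ψ s) * (r - s)) →
        ContDiff ℝ 1 B → StronglyMonotoneWith C_A (gradient B) →
        (∀ p, ‖gradient B p - gradient A p‖ ≤ η) →
      ∀ (N : ℕ) (t : Fin (N + 1) → ℝ), IsTimeGrid T N t →
        (∀ j : Fin N, Cψ / ε ^ 2 * stepSize t j ≤ c) →
      ∀ (u : ℝ → L2 Ω) (y z : ℝ → H1 Ω),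
        IsDiscreteState Ω ε A ψ t y₀ u y → IsDiscreteState Ω ε B ψ t y₀ u z →
        eLpNorm (fun s => fn (y s) - fn (z s)) ∞ (volume.restrict (Ioo 0 T))
          + eLpNorm (fun s => wgrad (y s) - wgrad (z s)) 2 (volume.restrict (Ioo 0 T))
        ≤ ENNReal.ofReal (C * η) := by
  have : IsFiniteMeasure (volume.restrict Ω) := isFiniteMeasure_restrict.2 hΩ
  set Q := Real.exp (2 * (Cψ / ε ^ 2) / (1 - c) * T) * (T * (volume.restrict Ω).real univ / C_A)
    with hQ
  refine ⟨√Q + √(Q / C_A) + 1, by positivity, ?_⟩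
  intro A B ψ y₀ C₀ C₁ η hA hgrowth hCψ hψ hB hmono hAB N t ht hstep u y z hy hz
  have hη : 0 ≤ η := (norm_nonneg _).trans (hAB 0)
  have sqrt_mul_sq (q : ℝ) : √(q * η ^ 2) = √q * η := by
    rw [Real.sqrt_mul' q (sq_nonneg η), Real.sqrt_sq hη]
  obtain ⟨state_sq_le, gradient_sq_le⟩ :=
    hy.error_sq_le hε hC_A hCψ hc hA hgrowth hψ hB hmono hAB ht hstep hz
  simp only [← hQ] at state_sq_le gradient_sq_le
  rw [← le_div_iff₀' hC_A, mul_div_right_comm] at gradient_sq_le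
  have state_le := (hy.piecewise_const.map₂ hz.piecewise_const
    fun v w => fn v - fn w).eLpNorm_top_le fun j => Real.le_sqrt_of_sq_le (state_sq_le j.succ)
  have gradient_le := ((hy.piecewise_const.map₂ hz.piecewise_const
    fun v w => wgrad v - wgrad w).eLpNorm_two_le ht.strictMono.monotone).trans
      (ENNReal.ofReal_le_ofReal (Real.sqrt_le_sqrt gradient_sq_le))
  rw [ht.first, ht.last, ← restrict_Ioo_eq_restrict_Ioc, sqrt_mul_sq] at state_le gradient_le
  calc _ ≤ ENNReal.ofReal (√Q * η) + ENNReal.ofReal (√(Q / C_A) * η) :=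
        add_le_add state_le gradient_le
    _ = ENNReal.ofReal ((√Q + √(Q / C_A)) * η) := by
        rw [← ENNReal.ofReal_add (by positivity) (by positivity), add_mul]
    _ ≤ ENNReal.ofReal ((√Q + √(Q / C_A) + 1) * η) := ENNReal.ofReal_le_ofReal (by linarith)

theorem mainTheorem6 {d : ℕ} (Ω : Set (AllenCahn.E d)) (hΩ_open : IsOpen Ω)
    (hΩ_bdd : Bornology.IsBounded Ω)
    (T ε : ℝ) (hT : 0 < T) (hε : 0 < ε) (C_A Cψ c : ℝ) (hC_A : 0 < C_A) (hc : c < 1) :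
    ∃ C : ℝ, 0 < C ∧
      ∀ (A : AllenCahn.E d → ℝ) (ψ : ℝ → ℝ) (y₀ : AllenCahn.H1 Ω),
        AllenCahn.AnisotropyAssumption A →
        AllenCahn.PotentialAssumption ψ Cψ →
        IntegrableOn (fun x => ψ (AllenCahn.fn y₀ x)) Ω →
      ∀ (D : Set ℝ) (Aδ : ℝ → AllenCahn.E d → ℝ) (η : ℝ → ℝ),
        (∀ δ ∈ D, ContDiff ℝ 1 (Aδ δ)) →
        (∀ δ ∈ D, AllenCahn.StronglyMonotoneWith C_A (gradient (Aδ δ))) →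
        (∀ δ ∈ D, ∀ p, ‖gradient (Aδ δ) p - gradient A p‖ ≤ η δ) →
      ∀ (N : ℕ) (t : Fin (N + 1) → ℝ), AllenCahn.IsTimeGrid T N t →
        (∀ j : Fin N, Cψ / ε ^ 2 * AllenCahn.stepSize t j ≤ c) →
      ∀ u : ℝ → AllenCahn.L2 Ω, AllenCahn.IsPiecewiseConst t u →
      ∀ δ ∈ D, ∀ y yδ : ℝ → AllenCahn.H1 Ω,
        AllenCahn.IsDiscreteState Ω ε A ψ t y₀ u y →
        AllenCahn.IsDiscreteState Ω ε (Aδ δ) ψ t y₀ u yδ →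
        eLpNorm (fun s => AllenCahn.fn (y s) - AllenCahn.fn (yδ s)) ∞ (volume.restrict (Ioo 0 T))
          + eLpNorm (fun s => AllenCahn.wgrad (y s) - AllenCahn.wgrad (yδ s)) 2 (volume.restrict (Ioo 0 T))
        ≤ ENNReal.ofReal (C * η δ) := by
  obtain ⟨C, hC, error_le⟩ :=
    mainTheorem6_general Ω hΩ_bdd.measure_lt_top.ne T ε hε.ne' C_A Cψ c hC_A hc
  refine ⟨C, hC, fun A ψ y₀ hA hψ _ D Aδ η hAδ hmono hη N t ht hstep u _ δ hδ y yδ hy hyδ => ?_⟩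
  obtain ⟨C₀, growth⟩ := hA.growth
  exact error_le A (Aδ δ) ψ y₀ C₀ 0 (η δ) hA.contDiff (fun p => by simpa using growth p) hψ.nonneg
    hψ.neg_mul_sub_sq_le (hAδ δ hδ) (hmono δ hδ) (hη δ hδ) N t ht hstep u y yδ hy hyδ
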